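/- For an integer $n$ let $K_n$ be the $n$-th simplest cubic field, that is, the splitting field over $\mathbb{Q}$ of the polynomial $X^3+(n+3)X^2+nX-1$. For a number field $K$ with ring of integers $\mathcal{O}_K$, let the Pólya group $Po(K)$ be the subgroup of the ideal class group of $K$ generated by the classes of the ideals $$\Pi_q(K)=\prod_{\substack{\mathfrak p\subset\mathcal{O}_K\ \text{prime}\\ N_{K/\mathbb{Q}}(\mathfrak p)=q}}\mathfrak p\qquad(q\ge 1\text{ an integer}),$$ where $\Pi_q(K)=\mathcal{O}_K$ if no prime ideal of $\mathcal{O}_K$ has norm $q$. Theorem. Let $M>0$ be a real number. Then there are infinitely many (pairwise distinct as subfields of $\mathbb{C}$) simplest cubic fields $K_n$ with $n\ge 1$ such that $|Po(K_n)|>M$. -/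

import Mathlib

open scoped NumberField nonZeroDivisors

namespace LargePolya

noncomputable section

section PolyaGroup

variable (K : Type*) [Field K] [NumberField K]

/-- The set of prime ideals of `𝓞 K` of absolute norm `q`. -/
def primesOfNorm (q : ℕ) : Set (Ideal (𝓞 K)) :=
  {P | P.IsPrime ∧ Ideal.absNorm P = q}

lemma finite_primesOfNorm (q : ℕ) : (primesOfNorm K q).Finite := by
  refine (Ideal.finite_setOfPred_absNorm_eq (S := 𝓞 K) q).subset ?_
  rintro P ⟨-, hP⟩
  exact hP

/-- The product of all prime ideals of `𝓞 K` of absolute norm `q`; the empty product is `𝓞 K`. -/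
def normProduct (q : ℕ) : Ideal (𝓞 K) :=
  ∏ P ∈ (finite_primesOfNorm K q).toFinset, P

lemma normProduct_mem_nonZeroDivisors {q : ℕ} (hq : 0 < q) :
    normProduct K q ∈ (Ideal (𝓞 K))⁰ := by
  rw [mem_nonZeroDivisors_iff_ne_zero, normProduct, Finset.prod_ne_zero_iff]
  intro P hP h0
  have h : Ideal.absNorm P = q := ((finite_primesOfNorm K q).mem_toFinset.1 hP).2
  rw [h0, map_zero] at h
  omega

/-- The Pólya group of `K`: the subgroup of the ideal class group generated by the classes of the
ideals `normProduct K q`, for all positive integers `q`. -/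
def polyaGroup : Subgroup (ClassGroup (𝓞 K)) :=
  Subgroup.closure {c | ∃ (q : ℕ) (hq : 0 < q),
    c = ClassGroup.mk0 ⟨normProduct K q, normProduct_mem_nonZeroDivisors K hq⟩}

end PolyaGroup

section SimplestCubic

open Polynomial

/-- The polynomial `X ^ 3 + (n + 3) X ^ 2 + n X - 1` over `ℚ`. -/
def simplestCubicPoly (n : ℤ) : ℚ[X] :=
  X ^ 3 + C ((n : ℚ) + 3) * X ^ 2 + C (n : ℚ) * X - 1

/-- The simplest cubic field of parameter `n`: the splitting field of `simplestCubicPoly n`,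
taken inside `ℂ`. -/
def simplestCubicField (n : ℤ) : IntermediateField ℚ ℂ :=
  IntermediateField.adjoin ℚ ((simplestCubicPoly n).rootSet ℂ)

instance simplestCubicField_isSplittingField (n : ℤ) :
    (simplestCubicPoly n).IsSplittingField ℚ (simplestCubicField n) :=
  IntermediateField.adjoin_rootSet_isSplittingField
    (IsAlgClosed.splits _)

instance simplestCubicField_numberField (n : ℤ) : NumberField (simplestCubicField n) where
  to_charZero := inferInstance
  to_finiteDimensional :=
    Polynomial.IsSplittingField.finiteDimensional (simplestCubicField n) (simplestCubicPoly n)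

end SimplestCubic

end

end LargePolya

/-!
The field `K = K_n` is a cyclic cubic field, because `r ↦ -1 / (1 + r)` permutes the roots of its
defining polynomial. A prime `p > 3` that divides `n ^ 2 + 3 * n + 9` exactly once is totally
ramified in `K` (`absNorm_normProduct_of_exactly_dvd`): up to the shift `y = 3 * r + n + 3` the
defining polynomial is Eisenstein at `p`. So `normProduct K p` is then the prime above `p`, of
norm `p`. By the Chinese remainder theorem there are `n` with as many such primes as desired
(`exists_parameter_with_many_exact_divisors`).

Ramified primes contribute to the Pólya group, up to a bounded loss
(`two_pow_card_le_nine_mul_card_polyaGroup`). Let `T` be a finite set of primes `p` for which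
`normProduct K p` has norm `p`, and let `σ` generate the Galois group. The ideals
`I_S = ∏ p ∈ S, normProduct K p`, for `S ⊆ T`, are fixed by `σ`, so writing an ideal `I_S` in the
class of a fixed `I_R` as `c * I_R` gives a unit `σ c / c`. If the units of `c * I_R` and `c' * I_R`
differ by the cube of a unit `e`, then `(c / c') * e ^ 2 * σ e` is fixed by `σ`
(`exists_rat_of_map_eq_cube_mul`), hence rational, so that the two ideals differ by a rational
factor. Taking norms shows that they are equal, the norm of a rational factor being a cube. A cubic
field has unit rank at most two and torsion `±1`, so there are at most nine units modulo cubes, and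
`2 ^ #T ≤ 9 * |Po(K)|`. This is the elementary part of the computation of ambiguous ideal classes;
it avoids the cohomology of the unit group.

Once `|Po(K_n)|` is unbounded, infinitely many distinct fields must occur.
-/

namespace LargePolya

/-! ### Parameters with many exact prime divisors of `n ^ 2 + 3 * n + 9` -/

lemma exists_prime_gt_dvd_sq_add_self_add_one (N : ℕ) :
    ∃ p a : ℕ, p.Prime ∧ N < p ∧ p ∣ a ^ 2 + a + 1 := by
  refine ⟨Nat.minFac (N.factorial ^ 2 + N.factorial + 1), N.factorial, Nat.minFac_prime ?_, ?_,
    Nat.minFac_dvd _⟩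
  · have := N.factorial_pos
    omega
  · by_contra! hle
    set p := Nat.minFac (N.factorial ^ 2 + N.factorial + 1) with hp
    have hpp : p.Prime := Nat.minFac_prime (by have := N.factorial_pos; omega)
    have h1 : p ∣ N.factorial := (hpp.dvd_factorial).2 hle
    have h2 : p ∣ N.factorial ^ 2 + N.factorial :=
      dvd_add (dvd_pow h1 two_ne_zero) h1
    exact hpp.one_lt.ne' (Nat.dvd_one.1 ((Nat.dvd_add_right h2).1 (Nat.minFac_dvd _)))

lemma not_dvd_of_prime_gt_three {p : ℕ} (hp : p.Prime) (h3 : 3 < p) : ¬ p ∣ 27 := by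
  intro h
  have : p ∣ 3 := hp.dvd_of_dvd_pow (n := 3) (by simpa using h)
  exact absurd (Nat.le_of_dvd (by norm_num) this) (by omega)

/-- Infinitely many primes divide some value of `n ^ 2 + 3 * n + 9` exactly once. -/
lemma exists_prime_gt_exactly_dvd (N : ℕ) :
    ∃ p n : ℕ, p.Prime ∧ N < p ∧ 3 < p ∧ p ∣ n ^ 2 + 3 * n + 9 ∧ ¬ p ^ 2 ∣ n ^ 2 + 3 * n + 9 := by
  obtain ⟨p, a, hp, hNp, hpa⟩ := exists_prime_gt_dvd_sq_add_self_add_one (max N 3)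
  have h3 : 3 < p := (le_max_right _ _).trans_lt hNp
  have hd : p ∣ (3 * a) ^ 2 + 3 * (3 * a) + 9 := by
    have : (3 * a) ^ 2 + 3 * (3 * a) + 9 = 9 * (a ^ 2 + a + 1) := by ring
    rw [this]
    exact dvd_mul_of_dvd_right hpa _
  by_cases hsq : p ^ 2 ∣ (3 * a) ^ 2 + 3 * (3 * a) + 9
  · -- The root `3 * a` modulo `p` is simple, so the shift by `p` leaves a root modulo `p ^ 2`.
    have hexp : (3 * a + p) ^ 2 + 3 * (3 * a + p) + 9
        = ((3 * a) ^ 2 + 3 * (3 * a) + 9) + p * (6 * a + 3 + p) := by ring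
    refine ⟨p, 3 * a + p, hp, (le_max_left _ _).trans_lt hNp, h3, ?_, ?_⟩
    · rw [hexp]
      exact dvd_add hd (dvd_mul_right _ _)
    · rw [hexp, Nat.dvd_add_right hsq, sq]
      intro h
      have h1 : p ∣ 6 * a + 3 :=
        (Nat.dvd_add_left dvd_rfl).1 (Nat.dvd_of_mul_dvd_mul_left hp.pos h)
      have h2 : (6 * a + 3) * (6 * a + 3) + 27 = 36 * (a ^ 2 + a + 1) := by ring
      exact not_dvd_of_prime_gt_three hp h3 ((Nat.dvd_add_right (dvd_mul_of_dvd_left h1 _)).1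
        (h2 ▸ dvd_mul_of_dvd_right hpa _))
  · exact ⟨p, 3 * a, hp, (le_max_left _ _).trans_lt hNp, h3, hd, hsq⟩

lemma sq_add_three_mul_add_nine_dvd_congr {m a b d : ℕ} (hd : d ∣ m) (h : a ≡ b [MOD m]) :
    d ∣ a ^ 2 + 3 * a + 9 ↔ d ∣ b ^ 2 + 3 * b + 9 := by
  have h' : a ≡ b [MOD d] := h.of_dvd hd
  exact (((h'.pow 2).add (h'.mul_left 3)).add_right 9).dvd_iff dvd_rfl

lemma exists_parameter_with_many_exact_divisors (s : ℕ) :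
    ∃ n : ℕ, 1 ≤ n ∧ ∃ T : Finset ℕ, T.card = s ∧ ∀ p ∈ T, p.Prime ∧ 3 < p ∧
      p ∣ n ^ 2 + 3 * n + 9 ∧ ¬ p ^ 2 ∣ n ^ 2 + 3 * n + 9 := by
  induction s with
  | zero => exact ⟨1, le_rfl, ∅, rfl, by simp⟩
  | succ s ih =>
    obtain ⟨n, -, T, hT, hTp⟩ := ih
    obtain ⟨q, b, hq, hTq, hq3, hqb, hqb2⟩ := exists_prime_gt_exactly_dvd (T.sup id)
    have hlt : ∀ p ∈ T, p < q := fun p hp => (Finset.le_sup (f := id) hp).trans_lt hTq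
    have hqT : q ∉ T := fun h => lt_irrefl _ (hlt q h)
    have hcop : Nat.Coprime (∏ p ∈ T, p ^ 2) (q ^ 2) := by
      refine Nat.Coprime.prod_left fun p hp => Nat.Coprime.pow _ _ ?_
      exact (Nat.coprime_primes (hTp p hp).1 hq).2 (hlt p hp).ne
    obtain ⟨k, hk1, hk2⟩ := Nat.chineseRemainder hcop n b
    have hqk : q ∣ k ^ 2 + 3 * k + 9 :=
      (sq_add_three_mul_add_nine_dvd_congr (dvd_pow_self _ two_ne_zero) hk2).2 hqb
    refine ⟨k, ?_, insert q T, by rw [Finset.card_insert_of_notMem hqT, hT], ?_⟩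
    · rw [Nat.one_le_iff_ne_zero]
      rintro rfl
      exact not_dvd_of_prime_gt_three hq hq3 (hqk.trans ⟨3, by norm_num⟩)
    · intro p hp
      rcases Finset.mem_insert.1 hp with rfl | hp
      · exact ⟨hq, hq3, hqk, fun h => hqb2 ((sq_add_three_mul_add_nine_dvd_congr dvd_rfl hk2).1 h)⟩
      · obtain ⟨h1, h2, h3, h4⟩ := hTp p hp
        have hdvd : p ^ 2 ∣ ∏ p ∈ T, p ^ 2 := Finset.dvd_prod_of_mem _ hp
        exact ⟨h1, h2, (sq_add_three_mul_add_nine_dvd_congr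
            ((dvd_pow_self _ two_ne_zero).trans hdvd) hk1).2 h3,
          fun h => h4 ((sq_add_three_mul_add_nine_dvd_congr hdvd hk1).1 h)⟩

/-! ### Simplest cubic fields are cyclic cubic fields -/

section Cubic

open Polynomial

lemma simplestCubicPoly_natDegree (n : ℤ) : (simplestCubicPoly n).natDegree = 3 := by
  unfold simplestCubicPoly
  compute_degree!

lemma simplestCubicPoly_monic (n : ℤ) : (simplestCubicPoly n).Monic := by
  unfold simplestCubicPoly
  monicity!

lemma aeval_simplestCubicPoly {A : Type*} [CommRing A] [Algebra ℚ A] (n : ℤ) (x : A) :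
    aeval x (simplestCubicPoly n) = x ^ 3 + (n + 3) * x ^ 2 + n * x - 1 := by
  simp [simplestCubicPoly, map_ofNat]

lemma int_cubic_ne_zero (n r : ℤ) : r ^ 3 + (n + 3) * r ^ 2 + n * r - 1 ≠ 0 := by
  intro h
  -- The cubic takes only odd values at integers.
  have h2 := congrArg (Int.cast : ℤ → ZMod 2) h
  push_cast at h2
  generalize (n : ZMod 2) = a at h2
  generalize (r : ZMod 2) = b at h2
  revert a b
  decide

lemma simplestCubicPoly_irreducible (n : ℤ) : Irreducible (simplestCubicPoly n) := by
  have hdeg := simplestCubicPoly_natDegree n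
  rw [(simplestCubicPoly_monic n).irreducible_iff_roots_eq_zero_of_degree_le_three
    (by omega) (by omega), Multiset.eq_zero_iff_forall_notMem]
  intro x hx
  have hx0 : x ^ 3 + (n + 3) * x ^ 2 + n * x - 1 = 0 := by
    have := (mem_roots'.1 hx).2
    rw [IsRoot.def, ← coe_aeval_eq_eval, aeval_simplestCubicPoly] at this
    exact this
  have hmonic : (X ^ 3 + C (n + 3) * X ^ 2 + C n * X - 1 : ℤ[X]).Monic := by monicity!
  obtain ⟨r, hr⟩ := isInteger_of_is_root_of_monic hmonic (r := x)
    (by simpa [map_ofNat] using hx0)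
  rw [eq_intCast] at hr
  apply int_cubic_ne_zero n r
  rw [← hr] at hx0
  exact_mod_cast hx0

lemma isGalois_of_isSplittingField_simplestCubicPoly (K : Type*) [Field K] [NumberField K] (n : ℤ)
    [(simplestCubicPoly n).IsSplittingField ℚ K] : IsGalois ℚ K :=
  IsGalois.of_separable_splitting_field (simplestCubicPoly_irreducible n).separable

lemma exists_root_simplestCubicPoly (K : Type*) [Field K] [NumberField K] (n : ℤ)
    [(simplestCubicPoly n).IsSplittingField ℚ K] :
    ∃ r : K, r ^ 3 + (n + 3) * r ^ 2 + n * r - 1 = 0 := by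
  have hs := IsSplittingField.splits K (simplestCubicPoly n)
  obtain ⟨r, hr⟩ := hs.exists_eval_eq_zero (by
    rw [degree_map, degree_eq_natDegree (simplestCubicPoly_irreducible n).ne_zero,
      simplestCubicPoly_natDegree]
    norm_num)
  refine ⟨r, ?_⟩
  rwa [eval_map_algebraMap, aeval_simplestCubicPoly] at hr

/-- With one root `r`, the field contains the other two roots `-1 / (1 + r)` and `-(1 + r) / r`. -/
lemma finrank_of_isSplittingField_simplestCubicPoly (K : Type*) [Field K] [NumberField K] (n : ℤ)
    [(simplestCubicPoly n).IsSplittingField ℚ K] : Module.finrank ℚ K = 3 := by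
  obtain ⟨r, hr⟩ := exists_root_simplestCubicPoly K n
  have hr0 : r ≠ 0 := by
    rintro rfl
    simp at hr
  have hr1 : 1 + r ≠ 0 := by
    intro h
    have h' : r = -1 := by linear_combination h
    rw [h'] at hr
    apply one_ne_zero (α := K)
    linear_combination hr
  have hmem : r ∈ IntermediateField.adjoin ℚ {r} := IntermediateField.mem_adjoin_simple_self ℚ r
  have htop : IntermediateField.adjoin ℚ {r} = ⊤ := by
    rw [← top_le_iff, ← IntermediateField.toSubalgebra_le_toSubalgebra,
      IntermediateField.top_toSubalgebra,
      ← IsSplittingField.adjoin_rootSet K (simplestCubicPoly n), Algebra.adjoin_le_iff]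
    intro x hx
    have hx := (mem_rootSet.1 hx).2
    change x ∈ IntermediateField.adjoin ℚ {r}
    rw [aeval_simplestCubicPoly] at hx
    have hprod : (x - r) * ((x * (1 + r) + 1) * (x * r + (1 + r))) = 0 := by
      linear_combination r * (1 + r) * hx - (x ^ 2 + x) * hr
    have h1 : 1 + r ∈ IntermediateField.adjoin ℚ {r} := add_mem (one_mem _) hmem
    rcases mul_eq_zero.1 hprod with h | h
    · rwa [sub_eq_zero.1 h]
    rcases mul_eq_zero.1 h with h | h
    · have hx : x = -(1 + r)⁻¹ := by
        field_simp
        linear_combination h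
      rw [hx]
      exact neg_mem (inv_mem h1)
    · have hx : x = -((1 + r) * r⁻¹) := by
        field_simp
        linear_combination h
      rw [hx]
      exact neg_mem (mul_mem h1 (inv_mem hmem))
  rw [← IntermediateField.finrank_top' (F := ℚ) (E := K), ← htop,
    IntermediateField.adjoin.finrank (Algebra.IsIntegral.isIntegral r),
    ← minpoly.eq_of_irreducible_of_monic (simplestCubicPoly_irreducible n)
      (by rw [aeval_simplestCubicPoly, hr]) (simplestCubicPoly_monic n),
    simplestCubicPoly_natDegree]

end Cubic

/-! ### Totally ramified primes of simplest cubic fields -/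

section Ramification

variable {K : Type*} [Field K] [NumberField K]

lemma absNorm_span_intCast (a : ℤ) :
    Ideal.absNorm (Ideal.span {(a : 𝓞 K)}) = a.natAbs ^ Module.finrank ℚ K := by
  rw [Ideal.absNorm_span_singleton, ← eq_intCast (algebraMap ℤ (𝓞 K)) a, Algebra.norm_algebraMap,
    Int.natAbs_pow, NumberField.RingOfIntegers.rank]

/-- If the cube of a prime `P` of a cubic field divides the rational prime `p`, then `(p) = P ^ 3`,
so `P` is the only prime of norm `p`. -/
lemma primesOfNorm_eq_singleton (hdeg : Module.finrank ℚ K = 3) {p : ℕ} (hp : p.Prime)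
    {P : Ideal (𝓞 K)} [hP : P.IsPrime] (hdvd : P ^ 3 ∣ Ideal.span {(p : 𝓞 K)}) :
    primesOfNorm K p = {P} := by
  have hpn : Ideal.absNorm (Ideal.span {(p : 𝓞 K)}) = p ^ 3 := by
    simpa [hdeg] using absNorm_span_intCast (K := K) p
  have hPp : Ideal.absNorm P ∣ p := by
    have h := map_dvd Ideal.absNorm hdvd
    rw [map_pow, hpn] at h
    exact (Nat.pow_dvd_pow_iff three_ne_zero).1 h
  have hN : Ideal.absNorm P = p :=
    ((Nat.dvd_prime hp).1 hPp).resolve_left fun h => hP.ne_top (Ideal.absNorm_eq_one_iff.1 h)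
  have hcube : Ideal.span {(p : 𝓞 K)} = P ^ 3 := by
    obtain ⟨J, hJ⟩ := hdvd
    have h := congrArg Ideal.absNorm hJ
    rw [hpn, map_mul, map_pow, hN] at h
    have hJ1 : Ideal.absNorm J = 1 :=
      Nat.eq_of_mul_eq_mul_left (pow_pos hp.pos 3) (by rw [← h, mul_one])
    rw [hJ, Ideal.absNorm_eq_one_iff.1 hJ1, Ideal.mul_top]
  have hPmax : P.IsMaximal := hP.isMaximal (by
    rintro rfl
    exact hp.ne_zero (by simpa using hN.symm))
  ext Q
  constructor
  · rintro ⟨hQ, hQN⟩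
    have hpQ : Ideal.span {(p : 𝓞 K)} ≤ Q := by
      rw [Ideal.span_singleton_le_iff_mem, ← hQN]
      exact Q.absNorm_mem
    rw [hcube] at hpQ
    exact (hPmax.eq_of_le hQ.ne_top (hQ.le_of_pow_le hpQ)).symm
  · rintro rfl
    exact ⟨hP, hN⟩

lemma absNorm_normProduct_of_primesOfNorm_eq_singleton {q : ℕ} {P : Ideal (𝓞 K)}
    (h : primesOfNorm K q = {P}) : Ideal.absNorm (normProduct K q) = q := by
  have hP : P ∈ primesOfNorm K q := h ▸ rfl
  have : (finite_primesOfNorm K q).toFinset = {P} := by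
    ext Q
    simp [h]
  rw [normProduct, this, Finset.prod_singleton]
  exact hP.2

lemma intCast_mem_of_prime {P : Ideal (𝓞 K)} [hP : P.IsPrime] {p : ℕ} (hp : p.Prime)
    (hpP : (p : 𝓞 K) ∈ P) {a : ℤ} (ha : (a : 𝓞 K) ∈ P) : (p : ℤ) ∣ a := by
  by_contra h
  obtain ⟨s, t, hst⟩ := (Nat.prime_iff_prime_int.1 hp).coprime_iff_not_dvd.2 h
  apply hP.ne_top
  rw [Ideal.eq_top_iff_one]
  have h1 : (1 : 𝓞 K) = s * p + t * a := by exact_mod_cast hst.symm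
  rw [h1]
  exact add_mem (Ideal.mul_mem_left _ _ hpP) (Ideal.mul_mem_left _ _ ha)

/-- A prime `p > 3` dividing `m = n ^ 2 + 3 * n + 9` exactly once is totally ramified.  For a root
`r` the element `y = 3 * r + n + 3` satisfies `y ^ 3 = m * (9 * r + n + 6)`, and no prime above `p`
contains the second factor, so the cube of any such prime divides `p`. -/
lemma absNorm_normProduct_of_exactly_dvd (K : Type*) [Field K] [NumberField K] (n : ℕ)
    [(simplestCubicPoly n).IsSplittingField ℚ K] {p : ℕ} (hp : p.Prime) (h3 : 3 < p)
    (hdvd : p ∣ n ^ 2 + 3 * n + 9) (hsq : ¬ p ^ 2 ∣ n ^ 2 + 3 * n + 9) :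
    Ideal.absNorm (normProduct K p) = p := by
  obtain ⟨r, hr⟩ := exists_root_simplestCubicPoly K n
  have hdeg := finrank_of_isSplittingField_simplestCubicPoly K n
  have hint : IsIntegral ℤ r := by
    refine ⟨Polynomial.X ^ 3 + Polynomial.C ((n : ℤ) + 3) * Polynomial.X ^ 2
      + Polynomial.C (n : ℤ) * Polynomial.X - 1, by monicity!, ?_⟩
    simpa using hr
  obtain ⟨R, rfl⟩ : ∃ R : 𝓞 K, (R : K) = r := ⟨⟨r, hint⟩, rfl⟩
  have hR : R ^ 3 + (n + 3) * R ^ 2 + n * R - 1 = 0 := by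
    apply NumberField.RingOfIntegers.coe_injective
    simpa [map_ofNat] using hr
  obtain ⟨m, hm⟩ := hdvd
  have hpm : ¬ (p : ℤ) ∣ m := by
    intro h
    apply hsq
    rw [hm, sq]
    exact mul_dvd_mul_left p (Int.natCast_dvd_natCast.1 h)
  have hm' : (n : 𝓞 K) ^ 2 + 3 * n + 9 = p * m := by
    exact_mod_cast congrArg (Nat.cast (R := 𝓞 K)) hm
  have hy : (3 * R + n + 3) ^ 3 = p * (m * (9 * R + n + 6)) := by
    linear_combination 27 * hR + (9 * R + n + 6) * hm'
  have hpne : Ideal.span {(p : 𝓞 K)} ≠ ⊤ := by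
    intro h
    have h' := absNorm_span_intCast (K := K) p
    rw [Int.cast_natCast, h, Ideal.absNorm_top, hdeg, Int.natAbs_natCast] at h'
    exact (Nat.one_lt_pow three_ne_zero hp.one_lt).ne h'
  obtain ⟨P, hPmax, hle⟩ := Ideal.exists_le_maximal _ hpne
  have hP : P.IsPrime := hPmax.isPrime
  have hpP : (p : 𝓞 K) ∈ P := hle (Ideal.mem_span_singleton_self _)
  have hyP : 3 * R + n + 3 ∈ P := hP.mem_of_pow_mem 3 (hy ▸ Ideal.mul_mem_right _ _ hpP)
  have hnot : m * (9 * R + n + 6) ∉ P := by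
    intro h
    rcases hP.mem_or_mem h with h | h
    · exact hpm (intCast_mem_of_prime hp hpP (a := m) (by exact_mod_cast h))
    · -- Both factors in `P` put `2 * n + 3` in `P`, and `(2 * n + 3) ^ 2 + 27 = 4 * m`.
      have h27 : ((27 : ℤ) : 𝓞 K) ∈ P := by
        have : ((27 : ℤ) : 𝓞 K) = p * (4 * m)
            - (2 * n + 3) * (3 * (3 * R + n + 3) - (9 * R + n + 6)) := by
          push_cast
          linear_combination 4 * hm'
        rw [this]
        exact sub_mem (Ideal.mul_mem_right _ _ hpP)
          (Ideal.mul_mem_left _ _ (sub_mem (Ideal.mul_mem_left _ _ hyP) h))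
      exact not_dvd_of_prime_gt_three hp h3
        (by exact_mod_cast intCast_mem_of_prime hp hpP h27)
  refine absNorm_normProduct_of_primesOfNorm_eq_singleton
    (primesOfNorm_eq_singleton (P := P) hdeg hp ?_)
  have hcube : P ^ 3 ∣ Ideal.span {(p : 𝓞 K)} * Ideal.span {m * (9 * R + n + 6)} := by
    rw [Ideal.span_singleton_mul_span_singleton, ← hy, ← Ideal.span_singleton_pow]
    exact pow_dvd_pow_of_dvd (Ideal.dvd_span_singleton.2 hyP) 3
  refine IsCoprime.dvd_of_dvd_mul_right (IsCoprime.pow_left ?_) hcube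
  rw [Ideal.isCoprime_iff_sup_eq]
  exact hPmax.out.2 _ (left_lt_sup.2 (by rwa [Ideal.span_singleton_le_iff_mem]))

end Ramification

/-! ### Units of cubic fields modulo cubes -/

section Units

open NumberField.Units

variable {K : Type*} [Field K] [NumberField K]

lemma exists_eq_cube_of_mem_torsion (hdeg : Module.finrank ℚ K = 3) (ζ : torsion K) :
    (ζ : (𝓞 K)ˣ) ^ 3 = ζ := by
  rcases torsion_eq_one_or_neg_one_of_odd_finrank (by rw [hdeg]; decide) ζ with h | h
  · rw [h, one_pow]
  · rw [h, Odd.neg_one_pow (by decide)]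

/-- The classes of units modulo cubes are separated by the exponents modulo `3` with respect to a
fundamental system of units, because `-1` is a cube. -/
lemma exists_separating_units_mod_cubes (hdeg : Module.finrank ℚ K = 3) :
    ∃ f : (𝓞 K)ˣ → (Fin (rank K) → ZMod 3), ∀ u v, f u = f v → ∃ e, u = v * e ^ 3 := by
  choose ζ hζ _ using fun u : (𝓞 K)ˣ => exist_unique_eq_mul_prod K u
  refine ⟨fun u i => (ζ u).2 i, fun u v huv => ?_⟩
  have hk : ∀ i, ∃ k : ℤ, (ζ u).2 i = (ζ v).2 i + 3 * k := by
    intro i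
    obtain ⟨k, hk⟩ := (ZMod.intCast_eq_intCast_iff_dvd_sub _ _ 3).1 (congrFun huv i).symm
    exact ⟨k, by push_cast at hk; omega⟩
  choose k hk using hk
  refine ⟨(ζ u).1 * ((ζ v).1 : (𝓞 K)ˣ)⁻¹ * ∏ i, fundSystem K i ^ k i, ?_⟩
  have hu : (u : (𝓞 K)ˣ) = (ζ u).1 * ((∏ i, fundSystem K i ^ (ζ v).2 i)
      * (∏ i, fundSystem K i ^ k i) ^ 3) := by
    conv_lhs => rw [hζ u]
    congr 1
    rw [← Finset.prod_pow, ← Finset.prod_mul_distrib]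
    refine Finset.prod_congr rfl fun i _ => ?_
    rw [hk i, zpow_add, mul_comm 3, zpow_mul]
    norm_cast
  have hv : v = (ζ v).1 * ∏ i, fundSystem K i ^ (ζ v).2 i := hζ v
  generalize ∏ i, fundSystem K i ^ (ζ v).2 i = a at hu hv
  generalize (∏ i, fundSystem K i ^ k i) = b at hu ⊢
  rw [mul_pow, mul_pow, inv_pow, exists_eq_cube_of_mem_torsion hdeg,
    exists_eq_cube_of_mem_torsion hdeg]
  generalize ((ζ u).1 : (𝓞 K)ˣ) = c at hu ⊢
  generalize ((ζ v).1 : (𝓞 K)ˣ) = d at hv ⊢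
  rw [hu, hv, mul_comm c d⁻¹, mul_assoc d⁻¹, mul_assoc d, mul_left_comm a, mul_inv_cancel_left,
    mul_left_comm]

lemma rank_le_two (hdeg : Module.finrank ℚ K = 3) : rank K ≤ 2 := by
  have h1 := NumberField.InfinitePlace.card_add_two_mul_card_eq_rank K
  have h2 := NumberField.InfinitePlace.card_eq_nrRealPlaces_add_nrComplexPlaces K
  rw [rank]
  omega

lemma card_exponents_mod_three_le (hdeg : Module.finrank ℚ K = 3) :
    Fintype.card (Fin (rank K) → ZMod 3) ≤ 9 := by
  rw [Fintype.card_pi, Finset.prod_const, ZMod.card, Finset.card_univ, Fintype.card_fin]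
  exact Nat.pow_le_pow_right (by norm_num) (rank_le_two hdeg)

end Units

/-! ### Galois action on the generators of the Pólya group -/

section Galois

variable {K : Type*} [Field K] [NumberField K]

lemma absNorm_map_ringEquiv (τ : 𝓞 K ≃+* 𝓞 K) (I : Ideal (𝓞 K)) :
    Ideal.absNorm (I.map τ) = Ideal.absNorm I := by
  rw [Ideal.absNorm_apply, Ideal.absNorm_apply, Submodule.cardQuot_apply,
    Submodule.cardQuot_apply]
  exact Nat.card_congr (Ideal.quotientEquiv I (I.map τ) τ rfl).symm.toEquiv

lemma map_mem_primesOfNorm (τ : 𝓞 K ≃+* 𝓞 K) {q : ℕ} {P : Ideal (𝓞 K)}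
    (hP : P ∈ primesOfNorm K q) : P.map τ ∈ primesOfNorm K q := by
  have := hP.1
  exact ⟨Ideal.map_isPrime_of_equiv τ, by rw [absNorm_map_ringEquiv, hP.2]⟩

lemma map_normProduct (τ : 𝓞 K ≃+* 𝓞 K) (q : ℕ) :
    (normProduct K q).map τ = normProduct K q := by
  rw [normProduct, ← Ideal.mapHom_apply, map_prod]
  refine Finset.prod_bij (fun P _ => P.map τ) ?_ ?_ ?_ ?_
  · intro P hP
    simpa using map_mem_primesOfNorm τ (by simpa using hP)
  · intro P _ Q _ h
    have h : P.map τ = Q.map τ := h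
    rw [← Ideal.comap_map_of_bijective τ τ.bijective (I := P), h,
      Ideal.comap_map_of_bijective τ τ.bijective]
  · intro P hP
    exact ⟨P.map τ.symm, by simpa using map_mem_primesOfNorm τ.symm (by simpa using hP),
      Ideal.map_of_equiv τ.symm⟩
  · intro P _
    rfl

lemma map_prod_normProduct (τ : 𝓞 K ≃+* 𝓞 K) (S : Finset ℕ) :
    (∏ p ∈ S, normProduct K p).map τ = ∏ p ∈ S, normProduct K p := by
  rw [← Ideal.mapHom_apply, map_prod]
  exact Finset.prod_congr rfl fun p _ => map_normProduct τ p

lemma exists_generator_of_cubic [IsGalois ℚ K] (hdeg : Module.finrank ℚ K = 3) :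
    ∃ σ : K ≃ₐ[ℚ] K, (∀ x, σ (σ (σ x)) = x) ∧ ∀ x, σ x = x → ∃ q : ℚ, x = q := by
  have hcard : Nat.card (K ≃ₐ[ℚ] K) = 3 := by rw [IsGalois.card_aut_eq_finrank, hdeg]
  have : Fact (Nat.Prime 3) := ⟨Nat.prime_three⟩
  have : IsCyclic (K ≃ₐ[ℚ] K) := isCyclic_of_prime_card hcard
  obtain ⟨σ, hσ⟩ := IsCyclic.exists_generator (α := K ≃ₐ[ℚ] K)
  refine ⟨σ, fun x => ?_, fun x hx => ?_⟩
  · have h : σ ^ 3 = 1 := hcard ▸ pow_card_eq_one'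
    simpa [pow_succ] using congrArg (fun g : K ≃ₐ[ℚ] K => g x) h
  · have hfix : ∀ g : K ≃ₐ[ℚ] K, g x = x := by
      intro g
      have hs : σ ∈ MulAction.stabilizer (K ≃ₐ[ℚ] K) x := hx
      exact (Subgroup.zpowers_le.2 hs) (hσ g)
    obtain ⟨q, hq⟩ := (IsGalois.mem_range_algebraMap_iff_fixed x).2 hfix
    exact ⟨q, by simpa using hq.symm⟩

/-- If `σ d / d` is the cube of `e`, then `d * e ^ 2 * σ e` is rational: `σ` multiplies it by the
norm `N` of `e`, a rational number whose cube is `1` because `σ` has order `3`. -/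
lemma exists_rat_of_map_eq_cube_mul (σ : K ≃ₐ[ℚ] K) (hσ : ∀ x, σ (σ (σ x)) = x)
    (hfix : ∀ x, σ x = x → ∃ q : ℚ, x = q) {d e : K} (hd : d ≠ 0) (he : e ≠ 0)
    (h : σ d = e ^ 3 * d) : ∃ q : ℚ, d * (e ^ 2 * σ e) = q := by
  obtain ⟨N, hN⟩ := hfix (e * σ e * σ (σ e)) (by simp only [map_mul, hσ]; ring)
  have hb0 : d * (e ^ 2 * σ e) ≠ 0 :=
    mul_ne_zero hd (mul_ne_zero (pow_ne_zero 2 he) (by simpa using he))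
  have hb : σ (d * (e ^ 2 * σ e)) = N * (d * (e ^ 2 * σ e)) := by
    rw [← hN]
    simp only [map_mul, map_pow, h]
    ring
  have hN3 : (N : K) ^ 3 = 1 := by
    have h3 := hσ (d * (e ^ 2 * σ e))
    rw [hb, map_mul, map_ratCast, hb, map_mul, map_mul, map_ratCast, hb] at h3
    exact mul_right_cancel₀ hb0 (by linear_combination h3)
  have hN1 : N = 1 := by
    have : N ^ 3 = 1 ^ 3 := by exact_mod_cast hN3
    exact (Odd.strictMono_pow (by decide)).injective this
  refine hfix _ ?_
  rw [hb, hN1, Rat.cast_one, one_mul]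

lemma exists_unit_of_map_eq {τ : 𝓞 K ≃+* 𝓞 K} {I J : Ideal (𝓞 K)} (hI : I ≠ 0) (hJ : J ≠ 0)
    (hIτ : I.map τ = I) (hJτ : J.map τ = J) {x y : 𝓞 K}
    (h : Ideal.span {x} * I = Ideal.span {y} * J) :
    ∃ u : (𝓞 K)ˣ, τ x * y = u * (τ y * x) := by
  have hτ := congrArg (Ideal.map τ) h
  rw [Ideal.map_mul, Ideal.map_mul, hIτ, hJτ, Ideal.map_span, Ideal.map_span,
    Set.image_singleton, Set.image_singleton] at hτ
  have hspan : Ideal.span {τ y * x} = Ideal.span {τ x * y} := by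
    apply mul_right_cancel₀ (mul_ne_zero hI hJ)
    change Ideal.span {τ x} * I = Ideal.span {τ y} * J at hτ
    rw [← Ideal.span_singleton_mul_span_singleton, ← Ideal.span_singleton_mul_span_singleton]
    calc Ideal.span {τ y} * Ideal.span {x} * (I * J)
        = Ideal.span {τ y} * J * (Ideal.span {x} * I) := by ring
      _ = Ideal.span {τ x} * I * (Ideal.span {y} * J) := by rw [← hτ, h]
      _ = Ideal.span {τ x} * Ideal.span {y} * (I * J) := by ring
  obtain ⟨u, hu⟩ := Ideal.span_singleton_eq_span_singleton.1 hspan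
  exact ⟨u, by rw [← hu, mul_comm]⟩

/-- Two ideals invariant under a generator `σ` of the Galois group of a cyclic cubic field, in the
class of a third one, differ by a rational factor as soon as the units attached to them agree
modulo cubes. -/
lemma exists_int_span_mul_eq (σ : K ≃ₐ[ℚ] K) (hσ : ∀ x, σ (σ (σ x)) = x)
    (hfix : ∀ x, σ x = x → ∃ q : ℚ, x = q) {I I' J : Ideal (𝓞 K)} {x y x' y' : 𝓞 K}
    (hx : x ≠ 0) (hy : y ≠ 0) (hx' : x' ≠ 0) (hy' : y' ≠ 0)
    (h : Ideal.span {x} * I = Ideal.span {y} * J)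
    (h' : Ideal.span {x'} * I' = Ideal.span {y'} * J) {u u' e : (𝓞 K)ˣ}
    (hu : NumberField.RingOfIntegers.mapRingEquiv σ.toRingEquiv x * y
      = u * (NumberField.RingOfIntegers.mapRingEquiv σ.toRingEquiv y * x))
    (hu' : NumberField.RingOfIntegers.mapRingEquiv σ.toRingEquiv x' * y'
      = u' * (NumberField.RingOfIntegers.mapRingEquiv σ.toRingEquiv y' * x'))
    (he : u = u' * e ^ 3) :
    ∃ a b : ℤ, a ≠ 0 ∧ b ≠ 0 ∧
      Ideal.span {(a : 𝓞 K)} * I = Ideal.span {(b : 𝓞 K)} * I' := by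
  set τ := NumberField.RingOfIntegers.mapRingEquiv σ.toRingEquiv with hτ
  have hτc : ∀ z : 𝓞 K, ((τ z : 𝓞 K) : K) = σ z := fun z => rfl
  have hne : ∀ {z : 𝓞 K}, z ≠ 0 → (z : K) ≠ 0 := fun hz => by simpa using hz
  have hsne : ∀ {z : 𝓞 K}, z ≠ 0 → σ (z : K) ≠ 0 := fun hz => by simpa using hz
  have huK := congrArg (algebraMap (𝓞 K) K) hu
  have huK' := congrArg (algebraMap (𝓞 K) K) hu'
  rw [he] at huK
  simp only [map_mul, hτc, Units.val_mul, Units.val_pow_eq_pow_val, map_pow] at huK huK'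
  have hxK := hne hx
  have hyK := hne hy
  have hxK' := hne hx'
  have hyK' := hne hy'
  have hsx' := hsne hx'
  have hsy := hsne hy
  have hsy' := hsne hy'
  have heK : ((e : 𝓞 K) : K) ≠ 0 := hne e.ne_zero
  have hd : (x : K) * y' / (x' * y) ≠ 0 :=
    div_ne_zero (mul_ne_zero hxK hyK') (mul_ne_zero hxK' hyK)
  obtain ⟨q, hq⟩ := exists_rat_of_map_eq_cube_mul σ hσ hfix
    (d := (x : K) * y' / (x' * y)) (e := ((e : 𝓞 K) : K))
    hd heK (by
      simp only [map_div₀, map_mul]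
      rw [mul_div_assoc', div_eq_div_iff (mul_ne_zero hsx' hsy) (mul_ne_zero hxK' hyK)]
      linear_combination (σ (y' : K) * x') * huK
        - (((e : 𝓞 K) : K) ^ 3 * x * σ (y : K)) * huK')
  have hq0 : q ≠ 0 := by
    rintro rfl
    have : σ ((e : 𝓞 K) : K) ≠ 0 := by simp
    exact mul_ne_zero hd (mul_ne_zero (pow_ne_zero 2 heK) this) (by rw [hq, Rat.cast_zero])
  refine ⟨q.num, q.den, by simpa using hq0, by exact_mod_cast q.den_ne_zero, ?_⟩
  have hw : IsUnit ((e : 𝓞 K) ^ 2 * τ e) := (e.isUnit.pow 2).mul (e.isUnit.map τ)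
  have hxy : (q.den : 𝓞 K) * (x * y') * ((e : 𝓞 K) ^ 2 * τ e) = q.num * (x' * y) := by
    apply NumberField.RingOfIntegers.coe_injective
    rw [Rat.cast_def] at hq
    have hden : (q.den : K) ≠ 0 := by exact_mod_cast q.den_ne_zero
    field_simp at hq
    simp only [map_mul, hτc, map_pow, map_natCast, map_intCast]
    linear_combination hq
  have hspan : Ideal.span {(q.den : 𝓞 K)} * (Ideal.span {x} * Ideal.span {y'})
      = Ideal.span {(q.num : 𝓞 K)} * (Ideal.span {x'} * Ideal.span {y}) := by
    simp only [Ideal.span_singleton_mul_span_singleton]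
    rw [← hxy, Ideal.span_singleton_mul_right_unit hw]
  have hne0 : Ideal.span {x'} * Ideal.span {y} ≠ 0 := by
    simp [hx', hy]
  apply mul_left_cancel₀ hne0
  rw [Int.cast_natCast]
  calc Ideal.span {x'} * Ideal.span {y} * (Ideal.span {(q.num : 𝓞 K)} * I)
      = Ideal.span {(q.num : 𝓞 K)} * (Ideal.span {x'} * Ideal.span {y}) * I := by ring
    _ = Ideal.span {(q.den : 𝓞 K)} * Ideal.span {y'} * (Ideal.span {x} * I) := by
        rw [← hspan]; ring
    _ = Ideal.span {(q.den : 𝓞 K)} * Ideal.span {y} * (Ideal.span {y'} * J) := by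
        rw [h]; ring
    _ = _ := by rw [← h']; ring

end Galois

/-! ### Lower bound for the Pólya group -/

section LowerBound

variable {K : Type*} [Field K] [NumberField K]

/-- Products of distinct primes are determined by their classes modulo rational cubes. -/
lemma eq_of_cube_mul_prod_eq {T S S' : Finset ℕ} (hT : ∀ p ∈ T, p.Prime) (hS : S ⊆ T)
    (hS' : S' ⊆ T) {a b : ℕ} (ha : a ≠ 0) (hb : b ≠ 0)
    (h : a ^ 3 * ∏ p ∈ S, p = b ^ 3 * ∏ p ∈ S', p) : S = S' := by
  have key : ∀ R ⊆ T, ∀ c ≠ 0, ∀ p, p.Prime →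
      (c ^ 3 * ∏ q ∈ R, q).factorization p = 3 * c.factorization p + if p ∈ R then 1 else 0 := by
    intro R hR c hc p hp
    have hR0 : ∀ q ∈ R, q ≠ 0 := fun q hq => (hT q (hR hq)).ne_zero
    rw [Nat.factorization_mul (pow_ne_zero 3 hc) (Finset.prod_ne_zero_iff.2 hR0),
      Nat.factorization_pow, Nat.factorization_prod hR0]
    simp only [Finsupp.add_apply, Finsupp.smul_apply, smul_eq_mul, Finsupp.finsetSum_apply]
    congr 1
    rw [← Finset.sum_ite_eq' R p (fun _ => 1)]
    refine Finset.sum_congr rfl fun q hq => ?_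
    rw [(hT q (hR hq)).factorization, Finsupp.single_apply]
  have hmem : ∀ p ∈ T, (p ∈ S ↔ p ∈ S') := by
    intro p hp
    have h1 := key S hS a ha p (hT p hp)
    rw [h, key S' hS' b hb p (hT p hp)] at h1
    split_ifs at h1 <;> first | omega | tauto
  ext p
  exact ⟨fun hp => (hmem p (hS hp)).1 hp, fun hp => (hmem p (hS' hp)).2 hp⟩

lemma prod_normProduct_mem_nonZeroDivisors {S : Finset ℕ} (hS : ∀ p ∈ S, p.Prime) :
    ∏ p ∈ S, normProduct K p ∈ (Ideal (𝓞 K))⁰ :=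
  prod_mem fun p hp => normProduct_mem_nonZeroDivisors K (hS p hp).pos

lemma mk0_prod_normProduct_mem_polyaGroup {S : Finset ℕ} (hS : ∀ p ∈ S, p.Prime) :
    ClassGroup.mk0 ⟨∏ p ∈ S, normProduct K p, prod_normProduct_mem_nonZeroDivisors hS⟩
      ∈ polyaGroup K := by
  induction S using Finset.induction_on with
  | empty =>
    convert one_mem (polyaGroup K)
    rw [← map_one ClassGroup.mk0]
    congr 1
  | insert q S hq ih =>
    have hS' : ∀ p ∈ S, p.Prime := fun p hp => hS p (Finset.mem_insert_of_mem hp)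
    have hq0 := (hS q (Finset.mem_insert_self q S)).pos
    have : ClassGroup.mk0
        ⟨∏ p ∈ insert q S, normProduct K p, prod_normProduct_mem_nonZeroDivisors hS⟩
        = ClassGroup.mk0 ⟨normProduct K q, normProduct_mem_nonZeroDivisors K hq0⟩ * ClassGroup.mk0
          ⟨∏ p ∈ S, normProduct K p, prod_normProduct_mem_nonZeroDivisors hS'⟩ := by
      rw [← map_mul]
      congr 1
      exact Subtype.ext (Finset.prod_insert hq)
    rw [this]
    exact mul_mem (Subgroup.subset_closure ⟨q, hq0, rfl⟩) (ih hS')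

/-- Each class contains at most nine of the ideals `∏ p ∈ S, normProduct K p`, `S ⊆ T`: those in
the class of a fixed one have their units separated modulo cubes. -/
lemma card_le_nine_of_same_class [IsGalois ℚ K] (hdeg : Module.finrank ℚ K = 3) {T : Finset ℕ}
    (hT : ∀ p ∈ T, p.Prime ∧ Ideal.absNorm (normProduct K p) = p)
    {F : Finset (Finset ℕ)} (hF : F ⊆ T.powerset)
    (hclass : ∀ S ∈ F, ∀ S' ∈ F, ∃ x y : 𝓞 K, x ≠ 0 ∧ y ≠ 0 ∧
      Ideal.span {x} * ∏ p ∈ S, normProduct K p = Ideal.span {y} * ∏ p ∈ S', normProduct K p) :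
    F.card ≤ 9 := by
  rcases F.eq_empty_or_nonempty with rfl | ⟨S₀, hS₀⟩
  · simp
  have hsub : ∀ S ∈ F, S ⊆ T := fun S hS => Finset.mem_powerset.1 (hF hS)
  have hne : ∀ S ∈ F, ∏ p ∈ S, normProduct K p ≠ 0 := fun S hS =>
    nonZeroDivisors.ne_zero (prod_normProduct_mem_nonZeroDivisors
      fun p hp => (hT p (hsub S hS hp)).1)
  obtain ⟨σ, hσ, hfix⟩ := exists_generator_of_cubic hdeg
  have hex : ∀ S : F, ∃ x y : 𝓞 K, ∃ u : (𝓞 K)ˣ, x ≠ 0 ∧ y ≠ 0 ∧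
      Ideal.span {x} * ∏ p ∈ S.1, normProduct K p = Ideal.span {y} * ∏ p ∈ S₀, normProduct K p ∧
      NumberField.RingOfIntegers.mapRingEquiv σ.toRingEquiv x * y
        = u * (NumberField.RingOfIntegers.mapRingEquiv σ.toRingEquiv y * x) := by
    rintro ⟨S, hS⟩
    obtain ⟨x, y, hx, hy, h⟩ := hclass S hS S₀ hS₀
    obtain ⟨u, hu⟩ := exists_unit_of_map_eq (hne S hS) (hne S₀ hS₀)
      (map_prod_normProduct (NumberField.RingOfIntegers.mapRingEquiv σ.toRingEquiv) S)
      (map_prod_normProduct _ S₀) h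
    exact ⟨x, y, u, hx, hy, h, hu⟩
  choose x y u hx hy h hu using hex
  obtain ⟨f, hf⟩ := exists_separating_units_mod_cubes hdeg
  have hinj : Function.Injective fun S : F => f (u S) := by
    intro S S' hSS'
    obtain ⟨e, he⟩ := hf _ _ hSS'
    obtain ⟨a, b, ha, hb, hab⟩ := exists_int_span_mul_eq σ hσ hfix (hx S) (hy S) (hx S') (hy S')
      (h S) (h S') (hu S) (hu S') he
    have hnorm := congrArg Ideal.absNorm hab
    have hprod : ∀ R : F, ∏ p ∈ R.1, Ideal.absNorm (normProduct K p) = ∏ p ∈ R.1, p := fun R =>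
      Finset.prod_congr rfl fun p hp => (hT p (hsub R.1 R.2 hp)).2
    rw [map_mul, map_mul, absNorm_span_intCast, absNorm_span_intCast, hdeg, map_prod, map_prod,
      hprod, hprod] at hnorm
    exact Subtype.ext (eq_of_cube_mul_prod_eq (fun p hp => (hT p hp).1) (hsub _ S.2) (hsub _ S'.2)
      (Int.natAbs_ne_zero.2 ha) (Int.natAbs_ne_zero.2 hb) hnorm)
  have hcard := Fintype.card_le_of_injective _ hinj
  rw [Fintype.card_coe] at hcard
  exact hcard.trans (card_exponents_mod_three_le hdeg)

theorem two_pow_card_le_nine_mul_card_polyaGroup [IsGalois ℚ K] (hdeg : Module.finrank ℚ K = 3)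
    {T : Finset ℕ} (hT : ∀ p ∈ T, p.Prime ∧ Ideal.absNorm (normProduct K p) = p) :
    2 ^ T.card ≤ 9 * Nat.card (polyaGroup K) := by
  classical
  have hprime : ∀ S : T.powerset, ∀ p ∈ S.1, p.Prime := fun S p hp =>
    (hT p (Finset.mem_powerset.1 S.2 hp)).1
  let cl : T.powerset → polyaGroup K := fun S =>
    ⟨_, mk0_prod_normProduct_mem_polyaGroup (hprime S)⟩
  have : Fintype (polyaGroup K) := Fintype.ofFinite _
  have hbound := Finset.card_le_mul_card_image (s := (Finset.univ : Finset T.powerset)) (f := cl) 9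
    (by
      intro c _
      rw [← Finset.card_map (Function.Embedding.subtype _)]
      refine card_le_nine_of_same_class hdeg hT ?_ ?_
      · intro S hS
        obtain ⟨S, -, rfl⟩ := Finset.mem_map.1 hS
        exact S.2
      · intro S hS S' hS'
        obtain ⟨S, hSc, rfl⟩ := Finset.mem_map.1 hS
        obtain ⟨S', hSc', rfl⟩ := Finset.mem_map.1 hS'
        have heq : cl S = cl S' :=
          (Finset.mem_filter.1 hSc).2.trans (Finset.mem_filter.1 hSc').2.symm
        obtain ⟨x, y, hx, hy, h⟩ := ClassGroup.mk0_eq_mk0_iff.1 (congrArg Subtype.val heq)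
        exact ⟨x, y, hx, hy, h⟩)
  rw [Finset.card_univ, Fintype.card_coe, Finset.card_powerset] at hbound
  refine hbound.trans (Nat.mul_le_mul_left 9 ?_)
  rw [Nat.card_eq_fintype_card]
  exact Finset.card_le_univ _

end LowerBound

/-! ### Unbounded Pólya groups of simplest cubic fields -/

lemma exists_simplestCubicField_card_polyaGroup_gt (M : ℝ) :
    ∃ n : ℤ, 1 ≤ n ∧ M < Nat.card (polyaGroup (simplestCubicField n)) := by
  obtain ⟨s, hs⟩ := pow_unbounded_of_one_lt (9 * M) (one_lt_two (α := ℝ))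
  obtain ⟨n, hn, T, hTs, hT⟩ := exists_parameter_with_many_exact_divisors s
  refine ⟨n, by exact_mod_cast hn, ?_⟩
  have : IsGalois ℚ (simplestCubicField n) :=
    isGalois_of_isSplittingField_simplestCubicPoly _ (n : ℤ)
  have hle := two_pow_card_le_nine_mul_card_polyaGroup
    (finrank_of_isSplittingField_simplestCubicPoly (simplestCubicField n) n) (T := T)
    fun p hp => by
      obtain ⟨h1, h2, h3, h4⟩ := hT p hp
      exact ⟨h1, absNorm_normProduct_of_exactly_dvd _ n h1 h2 h3 h4⟩
  rw [hTs] at hle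
  have hle' : (2 : ℝ) ^ s ≤ 9 * Nat.card (polyaGroup (simplestCubicField n)) := by
    exact_mod_cast hle
  linarith

lemma card_polyaGroup_congr {K L : IntermediateField ℚ ℂ} [NumberField K] [NumberField L]
    (h : K = L) : Nat.card (polyaGroup K) = Nat.card (polyaGroup L) := by
  subst h
  rfl

end LargePolya

theorem theorem1p4 (M : ℝ) (hM : 0 < M) :
    {K : IntermediateField ℚ ℂ | ∃ n : ℤ, 1 ≤ n ∧ K = LargePolya.simplestCubicField n ∧
      M < (Nat.card (LargePolya.polyaGroup (LargePolya.simplestCubicField n)) : ℝ)}.Infinite := by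
  intro hfin
  -- A field whose Pólya group is larger than those of the finitely many fields of the set, and
  -- than `M`, belongs to the set: contradiction.
  choose! n hn hK hcard using fun (K : IntermediateField ℚ ℂ) (h : K ∈
    {K : IntermediateField ℚ ℂ | ∃ n : ℤ, 1 ≤ n ∧ K = LargePolya.simplestCubicField n ∧
      M < (Nat.card (LargePolya.polyaGroup (LargePolya.simplestCubicField n)) : ℝ)}) => h
  let c : IntermediateField ℚ ℂ → ℝ := fun K =>
    Nat.card (LargePolya.polyaGroup (LargePolya.simplestCubicField (n K)))
  obtain ⟨B, hB⟩ := (hfin.image c).bddAbove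
  obtain ⟨m, hm, hlt⟩ := LargePolya.exists_simplestCubicField_card_polyaGroup_gt (max M B)
  have hmem : LargePolya.simplestCubicField m ∈
      {K : IntermediateField ℚ ℂ | ∃ n : ℤ, 1 ≤ n ∧ K = LargePolya.simplestCubicField n ∧
        M < (Nat.card (LargePolya.polyaGroup (LargePolya.simplestCubicField n)) : ℝ)} :=
    ⟨m, hm, rfl, (le_max_left _ _).trans_lt hlt⟩
  have hle : c (LargePolya.simplestCubicField m) ≤ B := hB ⟨_, hmem, rfl⟩
  have heq : c (LargePolya.simplestCubicField m)
      = Nat.card (LargePolya.polyaGroup (LargePolya.simplestCubicField m)) := by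
    exact congrArg Nat.cast (LargePolya.card_polyaGroup_congr (hK _ hmem)).symm
  linarith [le_max_right M B]
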